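/- For a positive integer \(n\) let \(\sigma(n)=\sum_{d\mid n}d\) be the sum of the positive divisors of \(n\). For every integer \(k\ge 1\), \[ \sigma(2k)=\frac{8}{2k-1}\sum_{j=1}^{k-1}\sigma(j)\bigl(2\sigma(2k-j)+4\sigma(k-j)-5\sigma(2k-2j)\bigr)-\frac{4k+1}{2k-1}\,\sigma(k)+\frac{8}{2k-1}\,\sigma(k)^2, \] \[ \sigma(2k+1)=\frac1k\sum_{j=1}^{k}\sigma(j)\bigl(8\sigma(2k+1-j)-20\sigma(2k+1-2j)\bigr), \] where an empty sum is \(0\). Moreover, for every integer \(k\ge 1\), \[ (2k-1)\,\sigma(2k)\equiv(4k+7)\,\sigma(k)\pmod 8,\qquad \sigma(2k)\equiv\sigma(k)\pmod 2,\qquad k\,\sigma(2k+1)\equiv 0\pmod 4 . \] -/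

import Mathlib

open scoped ArithmeticFunction.sigma

open scoped ArithmeticFunction.sigma

/-! Liouville's method: for an even function `f`, the sum of `f (a - b) - f (a + b)` over positive
solutions of `a * x + b * y = n` collapses to a sum over divisors of `n` (`liouville_identity`). The
choice `f z = z ^ 2` turns the left side into `-4 * a * b`, hence into the convolution of `σ 1` with
itself, and gives Besge's formula. Restricting the same `f` to even `z` gives a second relation,
`even_convolution_identity`, involving also the sums of even divisors. These are `2 * σ 1 k` at `2 *
k` and `0` at odd arguments, which produces the terms with index `2 * j`. Eliminating `σ 3 n`
between the two relations leaves a recurrence for `σ 1 n`. For `n = 2 * k` a term in `σ 3 k`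
survives, and Besge's formula at `k` removes it. The congruences are read off after clearing
denominators. -/

/-- Positive integer solutions `(a, b, x, y)` of `a * x + b * y = n`. -/
def bilinearSols (n : ℕ) : Finset (ℕ × ℕ × ℕ × ℕ) :=
  (Finset.Icc 1 n ×ˢ Finset.Icc 1 n ×ˢ Finset.Icc 1 n ×ˢ Finset.Icc 1 n).filter
    fun p => p.1 * p.2.2.1 + p.2.1 * p.2.2.2 = n

theorem mem_bilinearSols {n a b x y : ℕ} :
    (a, b, x, y) ∈ bilinearSols n ↔
      0 < a ∧ 0 < b ∧ 0 < x ∧ 0 < y ∧ a * x + b * y = n := by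
  simp only [bilinearSols, Finset.mem_filter, Finset.mem_product, Finset.mem_Icc]
  constructor
  · rintro ⟨⟨h1, h2, h3, h4⟩, h⟩
    exact ⟨h1.1, h2.1, h3.1, h4.1, h⟩
  · rintro ⟨h1, h2, h3, h4, h⟩
    have := Nat.le_mul_of_pos_right a h3
    have := Nat.le_mul_of_pos_right b h4
    have := Nat.le_mul_of_pos_left x h1
    have := Nat.le_mul_of_pos_left y h2
    refine ⟨⟨⟨h1, ?_⟩, ⟨h2, ?_⟩, ⟨h3, ?_⟩, ⟨h4, ?_⟩⟩, h⟩ <;> omega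

/-! ### Liouville's identity -/

section Liouville

variable (n : ℕ)

theorem sum_bilinearSols_swap (P : ℕ → ℕ → Prop) [DecidableRel P] (g : ℕ → ℕ → ℤ) :
    ∑ p ∈ bilinearSols n with P p.1 p.2.1, g p.1 p.2.1 =
      ∑ p ∈ bilinearSols n with P p.2.1 p.1, g p.2.1 p.1 := by
  refine Finset.sum_nbij' (fun p => (p.2.1, p.1, p.2.2.2, p.2.2.1))
    (fun p => (p.2.1, p.1, p.2.2.2, p.2.2.1)) ?_ ?_ ?_ ?_ ?_ <;>
  · rintro ⟨a, b, x, y⟩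
    simp only [Finset.mem_filter, mem_bilinearSols]
    grind

/-- Rests on `a * x + b * y = (a - b) * x + b * (x + y)`, which trades an order condition on `a, b`
for one on `x, y`; the next two lemmas use variants of it. -/
theorem sum_sub_bilinearSols (f : ℤ → ℤ) :
    ∑ p ∈ bilinearSols n with p.2.1 < p.1, f ((p.1 : ℤ) - p.2.1) =
      ∑ p ∈ bilinearSols n with p.2.2.1 < p.2.2.2, f p.1 := by
  refine Finset.sum_nbij' (fun p => (p.1 - p.2.1, p.2.1, p.2.2.1, p.2.2.1 + p.2.2.2))
    (fun p => (p.1 + p.2.1, p.2.1, p.2.2.1, p.2.2.2 - p.2.2.1)) ?_ ?_ ?_ ?_ ?_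
  · rintro ⟨a, b, x, y⟩
    simp only [Finset.mem_filter, mem_bilinearSols]
    rintro ⟨⟨ha, hb, hx, hy, h⟩, hlt⟩
    obtain ⟨c, rfl⟩ := Nat.exists_eq_add_of_lt hlt
    refine ⟨⟨by omega, hb, hx, by omega, ?_⟩, by omega⟩
    rw [show b + c + 1 - b = c + 1 by omega, ← h]; ring
  · rintro ⟨a, b, x, y⟩
    simp only [Finset.mem_filter, mem_bilinearSols]
    rintro ⟨⟨ha, hb, hx, hy, h⟩, hlt⟩
    obtain ⟨c, rfl⟩ := Nat.exists_eq_add_of_lt hlt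
    refine ⟨⟨by omega, hb, hx, by omega, ?_⟩, by omega⟩
    rw [show x + c + 1 - x = c + 1 by omega, ← h]; ring
  · rintro ⟨a, b, x, y⟩
    simp only [Finset.mem_filter, mem_bilinearSols, Prod.mk.injEq]
    rintro ⟨-, hlt⟩
    simp [hlt.le]
  · rintro ⟨a, b, x, y⟩
    simp only [Finset.mem_filter, mem_bilinearSols, Prod.mk.injEq]
    rintro ⟨-, hlt⟩
    simp [hlt.le]
  · rintro ⟨a, b, x, y⟩
    simp only [Finset.mem_filter, mem_bilinearSols]
    rintro ⟨-, hlt⟩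
    rw [Nat.cast_sub hlt.le]

theorem sum_add_bilinearSols (f : ℤ → ℤ) :
    ∑ p ∈ bilinearSols n with p.2.2.1 < p.2.2.2, f ((p.1 : ℤ) + p.2.1) =
      ∑ p ∈ bilinearSols n with p.2.1 < p.1, f p.1 := by
  refine Finset.sum_nbij' (fun p => (p.1 + p.2.1, p.2.1, p.2.2.1, p.2.2.2 - p.2.2.1))
    (fun p => (p.1 - p.2.1, p.2.1, p.2.2.1, p.2.2.1 + p.2.2.2)) ?_ ?_ ?_ ?_ ?_
  · rintro ⟨a, b, x, y⟩
    simp only [Finset.mem_filter, mem_bilinearSols]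
    rintro ⟨⟨ha, hb, hx, hy, h⟩, hlt⟩
    obtain ⟨c, rfl⟩ := Nat.exists_eq_add_of_lt hlt
    refine ⟨⟨by omega, hb, hx, by omega, ?_⟩, by omega⟩
    rw [show x + c + 1 - x = c + 1 by omega, ← h]; ring
  · rintro ⟨a, b, x, y⟩
    simp only [Finset.mem_filter, mem_bilinearSols]
    rintro ⟨⟨ha, hb, hx, hy, h⟩, hlt⟩
    obtain ⟨c, rfl⟩ := Nat.exists_eq_add_of_lt hlt
    refine ⟨⟨by omega, hb, hx, by omega, ?_⟩, by omega⟩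
    rw [show b + c + 1 - b = c + 1 by omega, ← h]; ring
  · rintro ⟨a, b, x, y⟩
    simp only [Finset.mem_filter, mem_bilinearSols, Prod.mk.injEq]
    rintro ⟨-, hlt⟩
    simp [hlt.le]
  · rintro ⟨a, b, x, y⟩
    simp only [Finset.mem_filter, mem_bilinearSols, Prod.mk.injEq]
    rintro ⟨-, hlt⟩
    simp [hlt.le]
  · rintro ⟨a, b, x, y⟩ -
    simp

theorem sum_lt_bilinearSols (f : ℤ → ℤ) :
    ∑ p ∈ bilinearSols n with p.2.2.2 < p.2.2.1, f p.1 =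
      ∑ p ∈ bilinearSols n with p.1 < p.2.1, f p.1 := by
  refine Finset.sum_nbij' (fun p => (p.1, p.1 + p.2.1, p.2.2.1 - p.2.2.2, p.2.2.2))
    (fun p => (p.1, p.2.1 - p.1, p.2.2.1 + p.2.2.2, p.2.2.2)) ?_ ?_ ?_ ?_ ?_
  · rintro ⟨a, b, x, y⟩
    simp only [Finset.mem_filter, mem_bilinearSols]
    rintro ⟨⟨ha, hb, hx, hy, h⟩, hlt⟩
    obtain ⟨c, rfl⟩ := Nat.exists_eq_add_of_lt hlt
    refine ⟨⟨ha, by omega, by omega, hy, ?_⟩, by omega⟩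
    rw [show y + c + 1 - y = c + 1 by omega, ← h]; ring
  · rintro ⟨a, b, x, y⟩
    simp only [Finset.mem_filter, mem_bilinearSols]
    rintro ⟨⟨ha, hb, hx, hy, h⟩, hlt⟩
    obtain ⟨c, rfl⟩ := Nat.exists_eq_add_of_lt hlt
    refine ⟨⟨ha, by omega, by omega, hy, ?_⟩, by omega⟩
    rw [show a + c + 1 - a = c + 1 by omega, ← h]; ring
  · rintro ⟨a, b, x, y⟩
    simp only [Finset.mem_filter, mem_bilinearSols, Prod.mk.injEq]
    rintro ⟨-, hlt⟩
    simp [hlt.le]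
  · rintro ⟨a, b, x, y⟩
    simp only [Finset.mem_filter, mem_bilinearSols, Prod.mk.injEq]
    rintro ⟨-, hlt⟩
    simp [hlt.le]
  · rintro ⟨a, b, x, y⟩ -
    simp

/-- On this diagonal the equation reads `a * (x + y) = n`, and a codivisor `e` splits as `x + y` in
`e - 1` ways. -/
theorem sum_bilinearSols_left_eq (g : ℕ → ℤ) :
    ∑ p ∈ bilinearSols n with p.1 = p.2.1, g p.1 =
      ∑ q ∈ n.divisorsAntidiagonal, ((q.2 : ℤ) - 1) * g q.1 := by
  have h1 : ∀ q ∈ n.divisorsAntidiagonal,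
      ((q.2 : ℤ) - 1) * g q.1 = ∑ _l ∈ Finset.Ico 1 q.2, g q.1 := by
    rintro ⟨d, e⟩ hq
    have he : 1 ≤ e := Nat.pos_of_ne_zero (Nat.ne_zero_of_mem_divisorsAntidiagonal hq).2
    simp [Nat.cast_sub he]
  rw [Finset.sum_congr rfl h1, Finset.sum_sigma']
  refine Finset.sum_nbij' (fun p => ⟨(p.1, p.2.2.1 + p.2.2.2), p.2.2.1⟩)
    (fun s => (s.1.1, s.1.1, s.2, s.1.2 - s.2)) ?_ ?_ ?_ ?_ ?_
  · rintro ⟨a, b, x, y⟩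
    simp only [Finset.mem_filter, mem_bilinearSols, Finset.mem_sigma, Finset.mem_Ico,
      Nat.mem_divisorsAntidiagonal]
    rintro ⟨⟨ha, hb, hx, hy, h⟩, rfl⟩
    refine ⟨⟨by rw [← h]; ring, ?_⟩, hx, by omega⟩
    have := Nat.mul_pos ha hx
    omega
  · rintro ⟨⟨d, e⟩, l⟩
    simp only [Finset.mem_filter, mem_bilinearSols, Finset.mem_sigma, Finset.mem_Ico,
      Nat.mem_divisorsAntidiagonal]
    rintro ⟨⟨h, hn⟩, h1, h2⟩
    have hd : 0 < d := Nat.pos_of_ne_zero (by rintro rfl; simp at h; omega)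
    refine ⟨⟨hd, hd, h1, by omega, ?_⟩, trivial⟩
    rw [← mul_add, Nat.add_sub_cancel' h2.le, h]
  · rintro ⟨a, b, x, y⟩
    simp only [Finset.mem_filter, Prod.mk.injEq]
    rintro ⟨-, heq⟩
    simp [heq]
  · rintro ⟨⟨d, e⟩, l⟩
    simp only [Finset.mem_sigma, Finset.mem_Ico]
    rintro ⟨-, h1, h2⟩
    simp [Nat.add_sub_cancel' h2.le]
  · rintro ⟨a, b, x, y⟩ -
    rfl

/-- Here the equation reads `(a + b) * x = n`. Two arguments in `g` allow both `f (a + b)` and `f a`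
to be summed. -/
theorem sum_bilinearSols_right_eq (g : ℕ → ℕ → ℤ) :
    ∑ p ∈ bilinearSols n with p.2.2.1 = p.2.2.2, g p.1 (p.1 + p.2.1) =
      ∑ q ∈ n.divisorsAntidiagonal, ∑ l ∈ Finset.Ico 1 q.1, g l q.1 := by
  rw [Finset.sum_sigma']
  refine Finset.sum_nbij' (fun p => ⟨(p.1 + p.2.1, p.2.2.1), p.1⟩)
    (fun s => (s.2, s.1.1 - s.2, s.1.2, s.1.2)) ?_ ?_ ?_ ?_ ?_
  · rintro ⟨a, b, x, y⟩
    simp only [Finset.mem_filter, mem_bilinearSols, Finset.mem_sigma, Finset.mem_Ico,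
      Nat.mem_divisorsAntidiagonal]
    rintro ⟨⟨ha, hb, hx, hy, h⟩, rfl⟩
    refine ⟨⟨by rw [← h]; ring, ?_⟩, ha, by omega⟩
    have := Nat.mul_pos ha hx
    omega
  · rintro ⟨⟨d, e⟩, l⟩
    simp only [Finset.mem_filter, mem_bilinearSols, Finset.mem_sigma, Finset.mem_Ico,
      Nat.mem_divisorsAntidiagonal]
    rintro ⟨⟨h, hn⟩, h1, h2⟩
    have he : 0 < e := Nat.pos_of_ne_zero (by rintro rfl; simp at h; omega)
    refine ⟨⟨h1, by omega, he, he, ?_⟩, trivial⟩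
    rw [← add_mul, Nat.add_sub_cancel' h2.le, h]
  · rintro ⟨a, b, x, y⟩
    simp only [Finset.mem_filter, Prod.mk.injEq]
    rintro ⟨-, heq⟩
    simp [heq]
  · rintro ⟨⟨d, e⟩, l⟩
    simp only [Finset.mem_sigma, Finset.mem_Ico]
    rintro ⟨-, h1, h2⟩
    simp [Nat.add_sub_cancel' h2.le]
  · rintro ⟨a, b, x, y⟩ -
    rfl

theorem Finset.sum_trichotomy {ι : Type*} (s : Finset ι) (u v : ι → ℕ) (g : ι → ℤ) :
    ∑ i ∈ s, g i = ∑ i ∈ s with u i < v i, g i + ∑ i ∈ s with u i = v i, g i +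
      ∑ i ∈ s with v i < u i, g i := by
  simp only [Finset.sum_filter, ← Finset.sum_add_distrib]
  refine Finset.sum_congr rfl fun i _ => ?_
  rcases lt_trichotomy (u i) (v i) with h | h | h
  · simp [h, h.ne, h.le]
  · simp [h]
  · simp [h, h.ne', h.le]

/-- Liouville's identity for even functions. -/
theorem liouville_identity (f : ℤ → ℤ) (hf : ∀ z, f (-z) = f z) :
    ∑ p ∈ bilinearSols n, (f ((p.1 : ℤ) - p.2.1) - f ((p.1 : ℤ) + p.2.1)) =
      ∑ q ∈ n.divisorsAntidiagonal, (((q.2 : ℤ) - 1) * (f 0 + 2 * f q.1)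
        - ((q.1 : ℤ) - 1) * f q.1 - 2 * ∑ l ∈ Finset.Ico 1 q.1, f l) := by
  have swap_sub : ∑ p ∈ bilinearSols n with p.1 < p.2.1, f ((p.1 : ℤ) - p.2.1) =
      ∑ p ∈ bilinearSols n with p.2.1 < p.1, f ((p.1 : ℤ) - p.2.1) := by
    rw [sum_bilinearSols_swap n (fun a b => a < b) (fun a b => f ((a : ℤ) - b))]
    refine Finset.sum_congr rfl fun p _ => ?_
    -- The one place where evenness of `f` enters.
    rw [← hf, neg_sub]
  have swap_add : ∑ p ∈ bilinearSols n with p.2.2.2 < p.2.2.1, f ((p.1 : ℤ) + p.2.1) =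
      ∑ p ∈ bilinearSols n with p.2.2.1 < p.2.2.2, f ((p.1 : ℤ) + p.2.1) := by
    refine Finset.sum_nbij' (fun p => (p.2.1, p.1, p.2.2.2, p.2.2.1))
      (fun p => (p.2.1, p.1, p.2.2.2, p.2.2.1)) ?_ ?_ ?_ ?_ ?_ <;>
    · rintro ⟨a, b, x, y⟩
      simp only [Finset.mem_filter, mem_bilinearSols]
      grind
  have diag_sub : ∑ p ∈ bilinearSols n with p.1 = p.2.1, f ((p.1 : ℤ) - p.2.1) =
      ∑ q ∈ n.divisorsAntidiagonal, ((q.2 : ℤ) - 1) * f 0 := by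
    rw [← sum_bilinearSols_left_eq n (fun _ => f 0)]
    refine Finset.sum_congr rfl fun p hp => ?_
    rw [(Finset.mem_filter.1 hp).2, sub_self]
  have diag_add : ∑ p ∈ bilinearSols n with p.2.2.1 = p.2.2.2, f ((p.1 : ℤ) + p.2.1) =
      ∑ q ∈ n.divisorsAntidiagonal, ((q.1 : ℤ) - 1) * f q.1 := by
    have := sum_bilinearSols_right_eq n (fun _ d => f d)
    push_cast at this
    rw [this]
    refine Finset.sum_congr rfl fun q hq => ?_
    have hd : 1 ≤ q.1 := Nat.pos_of_ne_zero (Nat.ne_zero_of_mem_divisorsAntidiagonal hq).1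
    simp [Nat.cast_sub hd]
  -- Off the diagonals, the left side is twice the sum of `f a` over `x < y` minus that over `b <
  -- a`. Splitting the full sum of `f a` in both ways (`t3`, `t4`) and cancelling `e3` turns this
  -- difference into diagonal sums.
  have t1 := (bilinearSols n).sum_trichotomy (fun p => p.1) (fun p => p.2.1)
    (fun p => f ((p.1 : ℤ) - p.2.1))
  have t2 := (bilinearSols n).sum_trichotomy (fun p => p.2.2.1) (fun p => p.2.2.2)
    (fun p => f ((p.1 : ℤ) + p.2.1))
  have t3 := (bilinearSols n).sum_trichotomy (fun p => p.1) (fun p => p.2.1) (fun p => f p.1)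
  have t4 := (bilinearSols n).sum_trichotomy (fun p => p.2.2.1) (fun p => p.2.2.2)
    (fun p => f p.1)
  have e1 := sum_sub_bilinearSols n f
  have e2 := sum_add_bilinearSols n f
  have e3 := sum_lt_bilinearSols n f
  have e4 := sum_bilinearSols_left_eq n (fun a => f a)
  have e5 := sum_bilinearSols_right_eq n (fun a _ => f a)
  simp only [mul_add, Finset.sum_sub_distrib, Finset.sum_add_distrib, ← Finset.mul_sum,
    mul_left_comm _ (2 : ℤ)] at *
  linarith

end Liouville

/-! ### Divisor convolutions and Besge's formula -/

/-- Divisors `a` of `i` and `b` of `j` with `i + j = n` are solutions with `x = i / a`, `y = j / b`.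
The end terms vanish since `Nat.divisors 0` is empty. -/
theorem sum_antidiagonal_divisors_mul (n : ℕ) (u v : ℕ → ℤ) :
    ∑ q ∈ Finset.HasAntidiagonal.antidiagonal n, (∑ d ∈ q.1.divisors, u d) * ∑ d ∈ q.2.divisors, v d =
      ∑ p ∈ bilinearSols n, u p.1 * v p.2.1 := by
  simp only [Finset.sum_mul_sum, Finset.sum_sigma']
  refine Finset.sum_nbij' (fun s => (s.2.1, s.2.2, s.1.1 / s.2.1, s.1.2 / s.2.2))
    (fun p => ⟨(p.1 * p.2.2.1, p.2.1 * p.2.2.2), ⟨p.1, p.2.1⟩⟩) ?_ ?_ ?_ ?_ ?_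
  · rintro ⟨⟨i, j⟩, a, b⟩
    simp only [Finset.mem_sigma, mem_bilinearSols, Finset.HasAntidiagonal.mem_antidiagonal, Nat.mem_divisors]
    rintro ⟨h, ⟨⟨x, rfl⟩, hi⟩, ⟨y, rfl⟩, hj⟩
    simp only [mul_ne_zero_iff, ← Nat.pos_iff_ne_zero] at hi hj
    rw [Nat.mul_div_cancel_left _ hi.1, Nat.mul_div_cancel_left _ hj.1]
    exact ⟨hi.1, hj.1, hi.2, hj.2, h⟩
  · rintro ⟨a, b, x, y⟩
    simp only [Finset.mem_sigma, mem_bilinearSols, Finset.HasAntidiagonal.mem_antidiagonal, Nat.mem_divisors]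
    rintro ⟨ha, hb, hx, hy, h⟩
    exact ⟨h, ⟨dvd_mul_right _ _, by positivity⟩, dvd_mul_right _ _, by positivity⟩
  · rintro ⟨⟨i, j⟩, a, b⟩
    simp only [Finset.mem_sigma, Finset.HasAntidiagonal.mem_antidiagonal, Nat.mem_divisors]
    rintro ⟨h, ⟨hi, -⟩, hj, -⟩
    simp only [Nat.mul_div_cancel' hi, Nat.mul_div_cancel' hj]
  · rintro ⟨a, b, x, y⟩
    simp only [mem_bilinearSols]
    rintro ⟨ha, hb, hx, hy, h⟩
    simp only [Nat.mul_div_cancel_left _ ha, Nat.mul_div_cancel_left _ hb]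
  · rintro ⟨⟨i, j⟩, a, b⟩ -
    rfl

theorem sum_Ico_one_sq (d : ℕ) (hd : 1 ≤ d) :
    6 * ∑ l ∈ Finset.Ico 1 d, (l : ℤ) ^ 2 = 2 * (d : ℤ) ^ 3 - 3 * d ^ 2 + d := by
  induction d, hd using Nat.le_induction with
  | base => simp
  | succ d hd ih =>
    rw [Finset.sum_Ico_succ_top hd, mul_add, ih]
    push_cast
    ring

theorem sum_Ico_one_even_sq (d : ℕ) (hd : 1 ≤ d) :
    6 * ∑ l ∈ Finset.Ico 1 d, (if Even (l : ℤ) then (l : ℤ) ^ 2 else 0) =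
      (d : ℤ) ^ 3 - d + if Even (d : ℤ) then -3 * (d : ℤ) ^ 2 + 3 * d else 0 := by
  induction d, hd using Nat.le_induction with
  | base => simp
  | succ d hd ih =>
    rw [Finset.sum_Ico_succ_top hd, mul_add, ih]
    push_cast
    by_cases h : Even (d : ℤ)
    · simp only [h, if_true, Int.even_add_one, not_true_eq_false, if_false]
      ring
    · simp only [h, if_true, Int.even_add_one, not_false_eq_true, if_false]
      ring

theorem cast_sigma (m n : ℕ) : (σ m n : ℤ) = ∑ d ∈ n.divisors, (d : ℤ) ^ m := by
  simp [ArithmeticFunction.sigma_apply]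

theorem cast_sigma_one (n : ℕ) : (σ 1 n : ℤ) = ∑ d ∈ n.divisors, (d : ℤ) := by
  simp [cast_sigma]

/-- Besge's formula for the convolution of `σ` with itself. -/
theorem sum_sigma_mul_sigma (n : ℕ) :
    12 * ∑ q ∈ Finset.HasAntidiagonal.antidiagonal n, (σ 1 q.1 : ℤ) * σ 1 q.2 =
      5 * σ 3 n + (1 - 6 * (n : ℤ)) * σ 1 n := by
  have h := liouville_identity n (fun z => z ^ 2) (fun z => neg_sq z)
  have hl : ∑ p ∈ bilinearSols n, (((p.1 : ℤ) - p.2.1) ^ 2 - ((p.1 : ℤ) + p.2.1) ^ 2) =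
      -4 * ∑ p ∈ bilinearSols n, (p.1 : ℤ) * p.2.1 := by
    rw [Finset.mul_sum]
    exact Finset.sum_congr rfl fun p _ => by ring
  have hr : 3 * ∑ q ∈ n.divisorsAntidiagonal, (((q.2 : ℤ) - 1) * (0 ^ 2 + 2 * (q.1 : ℤ) ^ 2)
        - ((q.1 : ℤ) - 1) * (q.1 : ℤ) ^ 2 - 2 * ∑ l ∈ Finset.Ico 1 q.1, (l : ℤ) ^ 2) =
      ∑ q ∈ n.divisorsAntidiagonal, ((6 * (n : ℤ) - 1) * q.1 - 5 * (q.1 : ℤ) ^ 3) := by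
    rw [Finset.mul_sum]
    refine Finset.sum_congr rfl fun q hq => ?_
    have hd : 1 ≤ q.1 := Nat.pos_of_ne_zero (Nat.ne_zero_of_mem_divisorsAntidiagonal hq).1
    have hn : (q.1 : ℤ) * q.2 = n := by exact_mod_cast (Nat.mem_divisorsAntidiagonal.1 hq).1
    -- With `n = d * e`, the term `e * d ^ 2` becomes `n * d`, the source of the factor `n` in the
    -- formula.
    rw [← hn]
    linear_combination -sum_Ico_one_sq q.1 hd
  have hσ : ∑ q ∈ n.divisorsAntidiagonal, ((6 * (n : ℤ) - 1) * q.1 - 5 * (q.1 : ℤ) ^ 3) =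
      (6 * (n : ℤ) - 1) * σ 1 n - 5 * σ 3 n := by
    rw [Nat.sum_divisorsAntidiagonal (f := fun d _ => (6 * (n : ℤ) - 1) * d - 5 * (d : ℤ) ^ 3),
      Finset.sum_sub_distrib, ← Finset.mul_sum, ← Finset.mul_sum, ← cast_sigma, ← cast_sigma_one]
  have hc := sum_antidiagonal_divisors_mul n (fun d => d) (fun d => d)
  simp only [← cast_sigma_one] at hc
  rw [hc]
  linarith

/-! ### Even divisors and the second convolution identity -/

theorem sum_divisors_two_mul_even {k : ℕ} (g : ℕ → ℤ) :
    ∑ d ∈ (2 * k).divisors, (if Even d then g d else 0) = ∑ d ∈ k.divisors, g (2 * d) := by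
  rw [← Finset.sum_filter]
  symm
  refine Finset.sum_nbij' (fun d => 2 * d) (fun d => d / 2) ?_ ?_ ?_ ?_ ?_
  · intro d
    simp only [Nat.mem_divisors, Finset.mem_filter]
    rintro ⟨h, hk⟩
    exact ⟨⟨Nat.mul_dvd_mul_left 2 h, by omega⟩, even_two_mul d⟩
  · intro d
    simp only [Nat.mem_divisors, Finset.mem_filter]
    rintro ⟨⟨h, hk⟩, he⟩
    obtain ⟨c, rfl⟩ := he.two_dvd
    rw [Nat.mul_div_cancel_left _ two_pos]
    exact ⟨Nat.dvd_of_mul_dvd_mul_left two_pos h, by omega⟩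
  · intro d _
    exact Nat.mul_div_cancel_left _ two_pos
  · intro d hd
    exact Nat.mul_div_cancel' (Finset.mem_filter.1 hd).2.two_dvd
  · intro d _
    rfl

theorem sum_divisors_odd_even {n : ℕ} (hn : Odd n) (g : ℕ → ℤ) :
    ∑ d ∈ n.divisors, (if Even d then g d else 0) = 0 := by
  refine Finset.sum_eq_zero fun d hd => if_neg ?_
  exact Nat.not_even_iff_odd.2 (hn.of_dvd_nat (Nat.dvd_of_mem_divisors hd))

/-- Sum of the even divisors. -/
def evenDivisorSum (n : ℕ) : ℤ := ∑ d ∈ n.divisors, if Even d then (d : ℤ) else 0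

theorem evenDivisorSum_two_mul (k : ℕ) : evenDivisorSum (2 * k) = 2 * σ 1 k := by
  rw [evenDivisorSum, sum_divisors_two_mul_even, cast_sigma_one, Finset.mul_sum]
  simp

theorem evenDivisorSum_odd {n : ℕ} (hn : Odd n) : evenDivisorSum n = 0 :=
  sum_divisors_odd_even hn _

/-- Liouville's identity for the square cut off to even integers keeps only pairs `a, b` of equal
parity. With `e` the indicator of evenness, that condition is `1 - e a - e b + 2 * e a * e b`; by
symmetry the two middle terms merge. -/
theorem even_convolution_identity (n : ℕ) :
    12 * (∑ q ∈ Finset.HasAntidiagonal.antidiagonal n, (σ 1 q.1 : ℤ) * σ 1 q.2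
      - 2 * ∑ q ∈ Finset.HasAntidiagonal.antidiagonal n, evenDivisorSum q.1 * σ 1 q.2
      + 2 * ∑ q ∈ Finset.HasAntidiagonal.antidiagonal n, evenDivisorSum q.1 * evenDivisorSum q.2) =
      σ 3 n - σ 1 n
        + ∑ d ∈ n.divisors, (if Even d then 3 * (d : ℤ) ^ 3 + (3 - 6 * (n : ℤ)) * d else 0) := by
  have h := liouville_identity n (fun z => if Even z then z ^ 2 else 0) (fun z => by simp)
  have hl : ∑ p ∈ bilinearSols n, ((if Even ((p.1 : ℤ) - p.2.1) then ((p.1 : ℤ) - p.2.1) ^ 2 else 0)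
        - (if Even ((p.1 : ℤ) + p.2.1) then ((p.1 : ℤ) + p.2.1) ^ 2 else 0)) =
      -4 * (∑ p ∈ bilinearSols n, (p.1 : ℤ) * p.2.1
        - ∑ p ∈ bilinearSols n, (if Even p.1 then (p.1 : ℤ) else 0) * p.2.1
        - ∑ p ∈ bilinearSols n, (if Even p.2.1 then (p.2.1 : ℤ) else 0) * p.1
        + 2 * ∑ p ∈ bilinearSols n, (if Even p.1 then (p.1 : ℤ) else 0) *
          (if Even p.2.1 then (p.2.1 : ℤ) else 0)) := by
    rw [Finset.mul_sum _ _ (2 : ℤ), ← Finset.sum_sub_distrib, ← Finset.sum_sub_distrib,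
      ← Finset.sum_add_distrib, Finset.mul_sum]
    refine Finset.sum_congr rfl fun p _ => ?_
    by_cases h1 : Even p.1 <;> by_cases h2 : Even p.2.1 <;>
      simp only [Int.even_sub, Int.even_add, Int.even_coe_nat, h1, h2, if_true, if_false,
        iff_true, iff_false, not_true_eq_false] <;> ring
  have hs : ∑ p ∈ bilinearSols n, (if Even p.2.1 then (p.2.1 : ℤ) else 0) * p.1 =
      ∑ p ∈ bilinearSols n, (if Even p.1 then (p.1 : ℤ) else 0) * p.2.1 := by
    simpa using (sum_bilinearSols_swap n (fun _ _ => True)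
      (fun a b => (if Even a then (a : ℤ) else 0) * b)).symm
  have hr : 3 * ∑ q ∈ n.divisorsAntidiagonal,
        (((q.2 : ℤ) - 1) * ((if Even (0 : ℤ) then 0 ^ 2 else 0) +
          2 * (if Even (q.1 : ℤ) then (q.1 : ℤ) ^ 2 else 0))
        - ((q.1 : ℤ) - 1) * (if Even (q.1 : ℤ) then (q.1 : ℤ) ^ 2 else 0)
        - 2 * ∑ l ∈ Finset.Ico 1 q.1, (if Even (l : ℤ) then (l : ℤ) ^ 2 else 0)) =
      ∑ q ∈ n.divisorsAntidiagonal, ((q.1 : ℤ) - (q.1 : ℤ) ^ 3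
        - if Even q.1 then 3 * (q.1 : ℤ) ^ 3 + (3 - 6 * (n : ℤ)) * q.1 else 0) := by
    rw [Finset.mul_sum]
    refine Finset.sum_congr rfl fun q hq => ?_
    have hd : 1 ≤ q.1 := Nat.pos_of_ne_zero (Nat.ne_zero_of_mem_divisorsAntidiagonal hq).1
    have hn : (q.1 : ℤ) * q.2 = n := by exact_mod_cast (Nat.mem_divisorsAntidiagonal.1 hq).1
    have hq1 := sum_Ico_one_even_sq q.1 hd
    rw [← hn]
    by_cases h1 : Even q.1
    · simp only [Int.even_coe_nat, h1, if_true, Even.zero] at hq1 ⊢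
      linear_combination -hq1
    · simp only [Int.even_coe_nat, h1, if_false, Even.zero, if_true] at hq1 ⊢
      linear_combination -hq1
  have hσ : ∑ q ∈ n.divisorsAntidiagonal, ((q.1 : ℤ) - (q.1 : ℤ) ^ 3
        - if Even q.1 then 3 * (q.1 : ℤ) ^ 3 + (3 - 6 * (n : ℤ)) * q.1 else 0) =
        (σ 1 n : ℤ) - σ 3 n
        - ∑ d ∈ n.divisors, (if Even d then 3 * (d : ℤ) ^ 3 + (3 - 6 * (n : ℤ)) * d else 0) := by
    rw [Nat.sum_divisorsAntidiagonal (f := fun d _ => (d : ℤ) - (d : ℤ) ^ 3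
        - if Even d then 3 * (d : ℤ) ^ 3 + (3 - 6 * (n : ℤ)) * d else 0),
      Finset.sum_sub_distrib, Finset.sum_sub_distrib, ← cast_sigma, ← cast_sigma_one]
  have c1 := sum_antidiagonal_divisors_mul n (fun d => d) (fun d => d)
  have c2 := sum_antidiagonal_divisors_mul n (fun d => if Even d then (d : ℤ) else 0)
    (fun d => d)
  have c3 := sum_antidiagonal_divisors_mul n (fun d => if Even d then (d : ℤ) else 0)
    (fun d => if Even d then (d : ℤ) else 0)
  simp only [← evenDivisorSum.eq_def, ← cast_sigma_one] at c1 c2 c3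
  rw [c1, c2, c3]
  linarith

/-! ### Convolutions as sums over one index -/

theorem sum_antidiagonal_evenDivisorSum (n : ℕ) (g : ℕ → ℤ) (hg : g 0 = 0) (hn : 1 ≤ n) :
    ∑ q ∈ Finset.HasAntidiagonal.antidiagonal n, evenDivisorSum q.1 * g q.2 =
      2 * ∑ j ∈ Finset.Icc 1 ((n - 1) / 2), (σ 1 j : ℤ) * g (n - 2 * j) := by
  rw [Finset.Nat.sum_antidiagonal_eq_sum_range_succ (fun i j => evenDivisorSum i * g j),
    Finset.mul_sum]
  symm
  refine Finset.sum_of_injOn (fun j => 2 * j) (fun a _ b _ h => by simpa using h) ?_ ?_ ?_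
  · intro j hj
    simp only [Finset.coe_Icc, Set.mem_Icc, Finset.coe_range, Set.mem_Iio] at hj ⊢
    omega
  · intro i hi hi'
    rcases Nat.even_or_odd i with he | ho
    · obtain ⟨j, rfl⟩ := he.two_dvd
      simp only [Finset.mem_range] at hi
      by_cases h0 : j = 0
      · simp [h0, evenDivisorSum]
      -- The bound `(n - 1) / 2` stops short of `2 * j = n`, a term killed by `hg`.
      · by_cases h1 : 2 * j = n
        · simp [h1, hg]
        · refine absurd ⟨j, ?_, rfl⟩ hi'
          simp only [Finset.coe_Icc, Set.mem_Icc]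
          omega
    · rw [evenDivisorSum_odd ho, zero_mul]
  · intro j _
    simp only [evenDivisorSum_two_mul]
    ring

theorem sum_antidiagonal_eq_sum_Icc (n : ℕ) (g : ℕ → ℕ → ℤ) (h0 : ∀ i, g 0 i = 0)
    (h1 : ∀ i, g i 0 = 0) :
    ∑ q ∈ Finset.HasAntidiagonal.antidiagonal n, g q.1 q.2 = ∑ j ∈ Finset.Icc 1 (n - 1), g j (n - j) := by
  rw [Finset.Nat.sum_antidiagonal_eq_sum_range_succ g]
  symm
  refine Finset.sum_subset (fun j => by simp only [Finset.mem_Icc, Finset.mem_range]; omega) ?_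
  intro j hj hj'
  simp only [Finset.mem_Icc, Finset.mem_range] at hj hj'
  rcases Nat.eq_zero_or_pos j with rfl | hp
  · exact h0 _
  · rw [show n - j = 0 by omega, h1]

/-- Folding along `j ↦ 2 * k - j` fixes `j = k`, whence the square. -/
theorem sum_sigma_mul_sigma_two_mul (k : ℕ) (hk : 1 ≤ k) :
    ∑ q ∈ Finset.HasAntidiagonal.antidiagonal (2 * k), (σ 1 q.1 : ℤ) * σ 1 q.2 =
      2 * ∑ j ∈ Finset.Icc 1 (k - 1), (σ 1 j : ℤ) * σ 1 (2 * k - j) + (σ 1 k : ℤ) ^ 2 := by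
  rw [sum_antidiagonal_eq_sum_Icc _ (fun i j => (σ 1 i : ℤ) * σ 1 j) (by simp) (by simp),
    ← Finset.sum_subset (s₁ := Finset.Icc 1 (k - 1) ∪ ({k} ∪ Finset.Icc (k + 1) (2 * k - 1))),
    Finset.sum_union, Finset.sum_union, Finset.sum_singleton]
  · have : ∑ j ∈ Finset.Icc (k + 1) (2 * k - 1), (σ 1 j : ℤ) * σ 1 (2 * k - j) =
        ∑ j ∈ Finset.Icc 1 (k - 1), (σ 1 j : ℤ) * σ 1 (2 * k - j) := by
      refine Finset.sum_nbij' (fun j => 2 * k - j) (fun j => 2 * k - j) ?_ ?_ ?_ ?_ ?_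
      all_goals intro j hj; simp only [Finset.mem_Icc] at hj ⊢
      · omega
      · omega
      · omega
      · omega
      · rw [show 2 * k - (2 * k - j) = j by omega, mul_comm]
    rw [this, show 2 * k - k = k by omega]
    ring
  · simp
  · rw [Finset.disjoint_left]
    intro j
    simp only [Finset.mem_Icc, Finset.mem_union, Finset.mem_singleton]
    omega
  · intro j
    simp only [Finset.mem_Icc, Finset.mem_union, Finset.mem_singleton]
    omega
  · intro j
    simp only [Finset.mem_Icc, Finset.mem_union, Finset.mem_singleton]
    omega

theorem sum_sigma_mul_sigma_two_mul_add_one (k : ℕ) :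
    ∑ q ∈ Finset.HasAntidiagonal.antidiagonal (2 * k + 1), (σ 1 q.1 : ℤ) * σ 1 q.2 =
      2 * ∑ j ∈ Finset.Icc 1 k, (σ 1 j : ℤ) * σ 1 (2 * k + 1 - j) := by
  rw [sum_antidiagonal_eq_sum_Icc _ (fun i j => (σ 1 i : ℤ) * σ 1 j) (by simp) (by simp),
    ← Finset.sum_subset (s₁ := Finset.Icc 1 k ∪ Finset.Icc (k + 1) (2 * k)),
    Finset.sum_union]
  · have : ∑ j ∈ Finset.Icc (k + 1) (2 * k), (σ 1 j : ℤ) * σ 1 (2 * k + 1 - j) =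
        ∑ j ∈ Finset.Icc 1 k, (σ 1 j : ℤ) * σ 1 (2 * k + 1 - j) := by
      refine Finset.sum_nbij' (fun j => 2 * k + 1 - j) (fun j => 2 * k + 1 - j) ?_ ?_ ?_ ?_ ?_
      all_goals intro j hj; simp only [Finset.mem_Icc] at hj ⊢
      · omega
      · omega
      · omega
      · omega
      · rw [show 2 * k + 1 - (2 * k + 1 - j) = j by omega, mul_comm]
    rw [this]
    ring
  · rw [Finset.disjoint_left]
    intro j
    simp only [Finset.mem_Icc]
    omega
  · intro j
    simp only [Finset.mem_Icc, Finset.mem_union]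
    omega
  · intro j
    simp only [Finset.mem_Icc, Finset.mem_union]
    omega

/-! ### The recurrences and the congruences -/

theorem sigma_two_mul_recurrence (k : ℕ) (hk : 1 ≤ k) :
    (2 * (k : ℤ) - 1) * σ 1 (2 * k) =
      8 * ∑ j ∈ Finset.Icc 1 (k - 1), (σ 1 j : ℤ) *
        (2 * (σ 1 (2 * k - j) : ℤ) + 4 * (σ 1 (k - j) : ℤ) - 5 * (σ 1 (2 * k - 2 * j) : ℤ))
      - (4 * (k : ℤ) + 1) * σ 1 k + 8 * (σ 1 k : ℤ) ^ 2 := by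
  have hdiv : (2 * k - 1) / 2 = k - 1 := by omega
  have hw := sum_sigma_mul_sigma (2 * k)
  have hwk := sum_sigma_mul_sigma k
  have he := even_convolution_identity (2 * k)
  have hEσ := sum_antidiagonal_evenDivisorSum (2 * k) (fun j => σ 1 j) (by simp) (by omega)
  have hEE := sum_antidiagonal_evenDivisorSum (2 * k) evenDivisorSum (by simp [evenDivisorSum])
    (by omega)
  rw [hdiv] at hEσ hEE
  have hEE' : ∑ j ∈ Finset.Icc 1 (k - 1), (σ 1 j : ℤ) * evenDivisorSum (2 * k - 2 * j) =
      2 * ∑ j ∈ Finset.Icc 1 (k - 1), (σ 1 j : ℤ) * σ 1 (k - j) := by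
    rw [Finset.mul_sum]
    refine Finset.sum_congr rfl fun j _ => ?_
    rw [← Nat.mul_sub, evenDivisorSum_two_mul]
    ring
  have hd : ∑ d ∈ (2 * k).divisors,
      (if Even d then 3 * (d : ℤ) ^ 3 + (3 - 6 * ((2 * k : ℕ) : ℤ)) * d else 0) =
      24 * σ 3 k + (6 - 24 * (k : ℤ)) * σ 1 k := by
    rw [sum_divisors_two_mul_even (fun d => 3 * (d : ℤ) ^ 3 + (3 - 6 * ((2 * k : ℕ) : ℤ)) * d),
      cast_sigma, cast_sigma_one, Finset.mul_sum, Finset.mul_sum, ← Finset.sum_add_distrib]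
    refine Finset.sum_congr rfl fun d _ => ?_
    push_cast
    ring
  rw [hd, hEσ, hEE, hEE'] at he
  rw [sum_antidiagonal_eq_sum_Icc k (fun i j => (σ 1 i : ℤ) * σ 1 j) (by simp) (by simp)] at hwk
  have hsplit : ∑ j ∈ Finset.Icc 1 (k - 1), (σ 1 j : ℤ) *
        (2 * (σ 1 (2 * k - j) : ℤ) + 4 * (σ 1 (k - j) : ℤ) - 5 * (σ 1 (2 * k - 2 * j) : ℤ)) =
      2 * ∑ j ∈ Finset.Icc 1 (k - 1), (σ 1 j : ℤ) * σ 1 (2 * k - j)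
        + 4 * ∑ j ∈ Finset.Icc 1 (k - 1), (σ 1 j : ℤ) * σ 1 (k - j)
        - 5 * ∑ j ∈ Finset.Icc 1 (k - 1), (σ 1 j : ℤ) * σ 1 (2 * k - 2 * j) := by
    rw [Finset.mul_sum, Finset.mul_sum, Finset.mul_sum, ← Finset.sum_add_distrib,
      ← Finset.sum_sub_distrib]
    exact Finset.sum_congr rfl fun j _ => by ring
  have hsym := sum_sigma_mul_sigma_two_mul k hk
  push_cast at hw
  rw [hsplit]
  linarith

theorem sigma_two_mul_add_one_recurrence (k : ℕ) :
    (k : ℤ) * σ 1 (2 * k + 1) = ∑ j ∈ Finset.Icc 1 k, (σ 1 j : ℤ) *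
        (8 * (σ 1 (2 * k + 1 - j) : ℤ) - 20 * (σ 1 (2 * k + 1 - 2 * j) : ℤ)) := by
  have hodd : Odd (2 * k + 1) := odd_two_mul_add_one k
  have hdiv : (2 * k + 1 - 1) / 2 = k := by omega
  have hw := sum_sigma_mul_sigma (2 * k + 1)
  have he := even_convolution_identity (2 * k + 1)
  have hEσ := sum_antidiagonal_evenDivisorSum (2 * k + 1) (fun j => σ 1 j) (by simp) (by omega)
  -- Two indices with odd sum include an odd one, where `evenDivisorSum` vanishes.
  have hEE : ∑ q ∈ Finset.HasAntidiagonal.antidiagonal (2 * k + 1),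
      evenDivisorSum q.1 * evenDivisorSum q.2 = 0 := by
    refine Finset.sum_eq_zero fun q hq => ?_
    rw [Finset.HasAntidiagonal.mem_antidiagonal] at hq
    rcases Nat.even_or_odd q.1 with h | h
    · rw [evenDivisorSum_odd (n := q.2) (by grind), mul_zero]
    · rw [evenDivisorSum_odd h, zero_mul]
  rw [hdiv] at hEσ
  rw [sum_divisors_odd_even hodd, hEσ, hEE] at he
  have hsplit : ∑ j ∈ Finset.Icc 1 k, (σ 1 j : ℤ) *
        (8 * (σ 1 (2 * k + 1 - j) : ℤ) - 20 * (σ 1 (2 * k + 1 - 2 * j) : ℤ)) =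
      8 * ∑ j ∈ Finset.Icc 1 k, (σ 1 j : ℤ) * σ 1 (2 * k + 1 - j)
        - 20 * ∑ j ∈ Finset.Icc 1 k, (σ 1 j : ℤ) * σ 1 (2 * k + 1 - 2 * j) := by
    rw [Finset.mul_sum, Finset.mul_sum, ← Finset.sum_sub_distrib]
    exact Finset.sum_congr rfl fun j _ => by ring
  have hsym := sum_sigma_mul_sigma_two_mul_add_one k
  push_cast at hw
  rw [hsplit]
  linarith

theorem proposition7p1 (k : ℕ) (hk : 1 ≤ k) :
    ((σ 1 (2 * k) : ℕ) : ℚ) =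
        8 / (2 * (k : ℚ) - 1) *
            ∑ j ∈ Finset.Icc 1 (k - 1), (σ 1 j : ℚ) *
              (2 * (σ 1 (2 * k - j) : ℚ) + 4 * (σ 1 (k - j) : ℚ) - 5 * (σ 1 (2 * k - 2 * j) : ℚ))
          - (4 * (k : ℚ) + 1) / (2 * (k : ℚ) - 1) * (σ 1 k : ℚ)
          + 8 / (2 * (k : ℚ) - 1) * (σ 1 k : ℚ) ^ 2
    ∧ ((σ 1 (2 * k + 1) : ℕ) : ℚ) =
        1 / (k : ℚ) *
          ∑ j ∈ Finset.Icc 1 k, (σ 1 j : ℚ) *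
            (8 * (σ 1 (2 * k + 1 - j) : ℚ) - 20 * (σ 1 (2 * k + 1 - 2 * j) : ℚ))
    ∧ (2 * (k : ℤ) - 1) * (σ 1 (2 * k) : ℤ) ≡ (4 * (k : ℤ) + 7) * (σ 1 k : ℤ) [ZMOD 8]
    ∧ σ 1 (2 * k) ≡ σ 1 k [MOD 2]
    ∧ k * σ 1 (2 * k + 1) ≡ 0 [MOD 4] := by
  have he := sigma_two_mul_recurrence k hk
  have ho := sigma_two_mul_add_one_recurrence k
  have hmod : (2 * (k : ℤ) - 1) * (σ 1 (2 * k) : ℤ) ≡ (4 * (k : ℤ) + 7) * (σ 1 k : ℤ) [ZMOD 8] := by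
    rw [he]
    set X := ∑ j ∈ Finset.Icc 1 (k - 1), (σ 1 j : ℤ) *
      (2 * (σ 1 (2 * k - j) : ℤ) + 4 * (σ 1 (k - j) : ℤ) - 5 * (σ 1 (2 * k - 2 * j) : ℤ))
    -- The coefficient `k + 1` comes from `(4 * k + 7) + (4 * k + 1) = 8 * (k + 1)`.
    exact (Int.modEq_iff_dvd.2 ⟨(k + 1) * σ 1 k - X - (σ 1 k : ℤ) ^ 2, by ring⟩)
  have hk0 : (k : ℚ) ≠ 0 := by positivity
  have hk1 : 2 * (k : ℚ) - 1 ≠ 0 := by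
    have : (1 : ℚ) ≤ k := by exact_mod_cast hk
    linarith
  refine ⟨?_, ?_, hmod, ?_, ?_⟩
  · have he' := congrArg (Int.cast : ℤ → ℚ) he
    push_cast at he'
    field_simp
    linarith
  · have ho' := congrArg (Int.cast : ℤ → ℚ) ho
    push_cast at ho'
    field_simp
    linarith
  · rw [← Int.natCast_modEq_iff]
    -- Both coefficients in `hmod` are odd, so reducing it modulo `2` suffices.
    obtain ⟨c, hc⟩ := Int.modEq_iff_dvd.1 hmod
    exact Int.modEq_iff_dvd.2
      ⟨4 * σ 1 k - 4 * c + 2 * k * σ 1 k - k * σ 1 (2 * k), by push_cast; linarith⟩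
  · rw [← Int.natCast_modEq_iff]
    push_cast
    rw [ho, Int.modEq_zero_iff_dvd]
    refine Finset.dvd_sum fun j _ => Dvd.dvd.mul_left ?_ _
    exact ⟨2 * σ 1 (2 * k + 1 - j) - 5 * σ 1 (2 * k + 1 - 2 * j), by ring⟩
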